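/- Let $\mathcal G=(\mathrm V,\mathrm E)$ be a metric graph, i.e. a connected multigraph (multiple edges and self-loops allowed) with finitely many vertices and edges, in which every bounded edge $e$ is identified with an interval $I_e=[0,\ell_e]$, $\ell_e>0$, both of whose endpoints are glued to vertices, and every unbounded edge (half-line) $e$ is identified with $I_e=[0,+\infty)$, whose endpoint $0$ is glued to a vertex. Let $L^2(\mathcal G,\mathbb C^2)=\bigoplus_{e\in\mathrm E}L^2(I_e,\mathbb C^2)$ (Hilbert sum) and $H^1(\mathcal G,\mathbb C^2)=\bigoplus_{e\in\mathrm E}H^1(I_e,\mathbb C^2)$; for $\psi\in H^1(\mathcal G,\mathbb C^2)$ the values at endpoints of edges are those of the continuous representatives of the components $\psi_e=(\psi_e^1,\psi_e^2)^T$. Let $m,c>0$ and $$\sigma_1=\begin{pmatrix}0&1\\1&0\end{pmatrix},\qquad \sigma_3=\begin{pmatrix}1&0\\0&-1\end{pmatrix}.$$ The Dirac operator $\mathcal D$ with Kirchhoff-type vertex conditions is the operator in $L^2(\mathcal G,\mathbb C^2)$ acting as $$(\mathcal D\psi)_e=-\imath c\,\sigma_1\psi_e'+mc^2\,\sigma_3\psi_e,\qquad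 e\in\mathrm E,$$ on the domain of all $\psi\in H^1(\mathcal G,\mathbb C^2)$ such that, at every vertex $\mathrm v$ of $\mathcal G$, (i) $\psi^1_e(\mathrm v)=\psi^1_f(\mathrm v)$ for all edge endpoints $e,f\succ\mathrm v$ located at $\mathrm v$, and (ii) $\sum_{e\succ\mathrm v}\psi^2_e(\mathrm v)_\pm=0$, the sum being over all edge endpoints located at $\mathrm v$ (a self-loop at $\mathrm v$ contributes both of its endpoints), where $\psi^2_e(\mathrm v)_\pm$ stands for $\psi^2_e(0)$ or $-\psi^2_e(\ell_e)$ according to whether the endpoint has coordinate $0$ or $\ell_e$. **Theorem.** $\mathcal D$ is self-adjoint, i.e. it is densely defined and $\mathcal D^*=\mathcal D$ (with equality of domains). -/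

import Mathlib

open MeasureTheory
open scoped ContDiff

noncomputable section

/-- A metric graph: a connected multigraph (loops and multiple edges allowed) with vertex set `V`,
bounded edges `Es` and half-lines `Eh` (all taken to be finite types below). The bounded edge `e`
is a copy of `[0, len e]`, a half-line is a copy of `[0, ∞)`. The endpoint with coordinate `0` of
an edge `e` is glued to the vertex `init e`, the endpoint with coordinate `len e` of a bounded edge
`e` to the vertex `term e`. A half-line has only one endpoint. -/
structure MetricGraph (V Es Eh : Type*) where
  len : Es → ℝ
  len_pos : ∀ e, 0 < len e
  init : Es ⊕ Eh → V
  term : Es → V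
  nonempty : Nonempty V
  connected : ∀ v w : V,
    Relation.EqvGen (fun a b => ∃ e : Es, init (Sum.inl e) = a ∧ term e = b) v w

/-- The space `ℂ²` with its Hermitian norm. -/
abbrev Spinor : Type := EuclideanSpace ℂ (Fin 2)

/-- The space `L²(I, ℂ²)`. -/
abbrev L2On (I : Set ℝ) : Type := Lp Spinor 2 (volume.restrict I)

/-- `v` is the weak derivative of `u` in the interior of `I`. -/
def HasWeakDeriv (I : Set ℝ) (u v : L2On I) : Prop :=
  ∀ φ : ℝ → ℝ, ContDiff ℝ ∞ φ → HasCompactSupport φ → tsupport φ ⊆ interior I →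
    ∫ x in I, deriv φ x • u x = - ∫ x in I, φ x • v x

theorem integrable_smul_L2On {I : Set ℝ} {φ : ℝ → ℝ} (hφ : Continuous φ)
    (hc : HasCompactSupport φ) (u : L2On I) :
    Integrable (fun x => φ x • u x) (volume.restrict I) :=
  ((Lp.memLp u).locallyIntegrable (by norm_num)).integrable_smul_left_of_hasCompactSupport hφ hc

theorem HasWeakDeriv.add {I : Set ℝ} {u₁ v₁ u₂ v₂ : L2On I} (h₁ : HasWeakDeriv I u₁ v₁)
    (h₂ : HasWeakDeriv I u₂ v₂) : HasWeakDeriv I (u₁ + u₂) (v₁ + v₂) := by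
  intro φ hφ hc hI
  have hd : Continuous (deriv φ) := hφ.continuous_deriv (by simp)
  have e₁ : ∫ x in I, deriv φ x • (u₁ + u₂ : L2On I) x
      = ∫ x in I, (deriv φ x • u₁ x + deriv φ x • u₂ x) := by
    refine integral_congr_ae ?_
    filter_upwards [Lp.coeFn_add u₁ u₂] with x hx
    rw [hx, Pi.add_apply, smul_add]
  have e₂ : ∫ x in I, φ x • (v₁ + v₂ : L2On I) x
      = ∫ x in I, (φ x • v₁ x + φ x • v₂ x) := by
    refine integral_congr_ae ?_
    filter_upwards [Lp.coeFn_add v₁ v₂] with x hx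
    rw [hx, Pi.add_apply, smul_add]
  rw [e₁, e₂, integral_add (integrable_smul_L2On hd hc.deriv u₁)
    (integrable_smul_L2On hd hc.deriv u₂), integral_add (integrable_smul_L2On hφ.continuous hc v₁)
    (integrable_smul_L2On hφ.continuous hc v₂), h₁ φ hφ hc hI, h₂ φ hφ hc hI, neg_add]

theorem HasWeakDeriv.smul {I : Set ℝ} {u v : L2On I} (a : ℂ) (h : HasWeakDeriv I u v) :
    HasWeakDeriv I (a • u) (a • v) := by
  intro φ hφ hc hI
  have e₁ : ∫ x in I, deriv φ x • (a • u : L2On I) x = ∫ x in I, a • (deriv φ x • u x) := by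
    refine integral_congr_ae ?_
    filter_upwards [Lp.coeFn_smul a u] with x hx
    rw [hx, Pi.smul_apply, smul_comm]
  have e₂ : ∫ x in I, φ x • (a • v : L2On I) x = ∫ x in I, a • (φ x • v x) := by
    refine integral_congr_ae ?_
    filter_upwards [Lp.coeFn_smul a v] with x hx
    rw [hx, Pi.smul_apply, smul_comm]
  rw [e₁, e₂, integral_smul, integral_smul, h φ hφ hc hI, smul_neg]

theorem HasWeakDeriv.zero (I : Set ℝ) : HasWeakDeriv I 0 0 := by
  intro φ _ _ _
  have e : ∀ ψ : ℝ → ℝ, ∫ x in I, ψ x • (0 : L2On I) x = 0 := by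
    intro ψ
    refine integral_eq_zero_of_ae ?_
    filter_upwards [Lp.coeFn_zero Spinor 2 (volume.restrict I)] with x hx
    rw [hx]
    simp
  rw [e, e, neg_zero]

/-- Weak derivatives are unique when the boundary of `I` is a null set. -/
theorem HasWeakDeriv.unique {I : Set ℝ} (hI : volume (I \ interior I) = 0) {u v w : L2On I}
    (hv : HasWeakDeriv I u v) (hw : HasWeakDeriv I u w) : v = w := by
  have hres : volume.restrict I = volume.restrict (interior I) := by
    refine (Measure.restrict_congr_set ?_).symm
    refine (LE.le.eventuallyLE interior_subset).antisymm ?_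
    exact ae_le_set.2 hI
  have key : ∀ᵐ x ∂(volume : Measure ℝ), x ∈ interior I → (v x - w x) = 0 := by
    refine isOpen_interior.ae_eq_zero_of_integral_contDiff_smul_eq_zero ?_ ?_
    · have h : LocallyIntegrable (fun x => v x - w x) (volume.restrict I) :=
        ((Lp.memLp v).locallyIntegrable (by norm_num)).sub
          ((Lp.memLp w).locallyIntegrable (by norm_num))
      exact (locallyIntegrableOn_of_locallyIntegrable_restrict h).mono_set interior_subset
    · intro φ hφ hc hs
      have hsupp : ∀ x, x ∉ I → φ x • (v x - w x) = 0 := by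
        intro x hx
        have : φ x = 0 := by
          by_contra h0
          exact hx (interior_subset (hs (subset_tsupport _ h0)))
        rw [this, zero_smul]
      rw [← setIntegral_eq_integral_of_forall_compl_eq_zero hsupp]
      have := (hv φ hφ hc hs).symm.trans (hw φ hφ hc hs)
      simp only [smul_sub]
      rw [integral_sub (integrable_smul_L2On hφ.continuous hc v)
        (integrable_smul_L2On hφ.continuous hc w), sub_eq_zero]
      exact neg_injective this
  refine Lp.ext ?_
  have hae : ∀ᵐ x ∂(volume.restrict (interior I)), v x = w x := by
    rw [ae_restrict_iff' isOpen_interior.measurableSet]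
    filter_upwards [key] with x hx hxI
    exact sub_eq_zero.1 (hx hxI)
  exact hres.le.absolutelyContinuous.ae_le hae

/-- The Sobolev space `H¹(I, ℂ²)`, as a subspace of `L²(I, ℂ²)`. -/
def H1On (I : Set ℝ) : Submodule ℂ (L2On I) where
  carrier := {u | ∃ v, HasWeakDeriv I u v}
  zero_mem' := ⟨0, HasWeakDeriv.zero I⟩
  add_mem' := fun ⟨v, hv⟩ ⟨w, hw⟩ => ⟨v + w, hv.add hw⟩
  smul_mem' := fun a _ ⟨v, hv⟩ => ⟨a • v, hv.smul a⟩

/-- The weak derivative as a linear map `H¹(I, ℂ²) → L²(I, ℂ²)`. -/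
def weakDeriv (I : Set ℝ) (hI : volume (I \ interior I) = 0) : H1On I →ₗ[ℂ] L2On I where
  toFun u := u.2.choose
  map_add' u v := (u + v).2.choose_spec.unique hI (u.2.choose_spec.add v.2.choose_spec)
  map_smul' a u := (a • u).2.choose_spec.unique hI (u.2.choose_spec.smul a)

theorem hasWeakDeriv_weakDeriv (I : Set ℝ) (hI : volume (I \ interior I) = 0) (u : H1On I) :
    HasWeakDeriv I u (weakDeriv I hI u) := u.2.choose_spec

/-- The Pauli matrix `σ₁`. -/
def pauli1 : Matrix (Fin 2) (Fin 2) ℂ := !![0, 1; 1, 0]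

/-- The Pauli matrix `σ₃`. -/
def pauli3 : Matrix (Fin 2) (Fin 2) ℂ := !![1, 0; 0, -1]

/-- The pointwise action of a matrix on `L²(I, ℂ²)`. -/
def matrixAct (I : Set ℝ) (A : Matrix (Fin 2) (Fin 2) ℂ) : L2On I →L[ℂ] L2On I :=
  (Matrix.toEuclideanCLM (n := Fin 2) (𝕜 := ℂ) A).compLpL 2 (volume.restrict I)

namespace MetricGraph

variable {V Es Eh : Type*} (G : MetricGraph V Es Eh)

/-- The interval `I_e` of the edge `e`. -/
def interval : Es ⊕ Eh → Set ℝ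
  | Sum.inl e => Set.Icc 0 (G.len e)
  | Sum.inr _ => Set.Ici 0

theorem volume_interval_diff (e : Es ⊕ Eh) :
    volume (G.interval e \ interior (G.interval e)) = 0 := by
  rcases e with e | e
  · refine measure_mono_null (t := {0, G.len e}) ?_ (Set.Finite.measure_zero (by simp) _)
    rintro x ⟨hx, hx'⟩
    simp only [interval, interior_Icc, Set.mem_Icc, Set.mem_Ioo] at hx hx'
    simp only [Set.mem_insert_iff, Set.mem_singleton_iff]
    grind
  · refine measure_mono_null (t := {0}) ?_ (Set.Finite.measure_zero (by simp) _)
    rintro x ⟨hx, hx'⟩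
    simp only [interval, interior_Ici, Set.mem_Ici, Set.mem_Ioi] at hx hx'
    simp only [Set.mem_singleton_iff]
    grind

/-- The endpoints of the edges: `Sum.inl e` is the endpoint with coordinate `0` of an arbitrary
edge `e`, and `Sum.inr e` is the endpoint with coordinate `len e` of a bounded edge `e`. A loop
thus contributes two distinct endpoints at its vertex. -/
abbrev Endpoint (Es Eh : Type*) := (Es ⊕ Eh) ⊕ Es

/-- The vertex at which an endpoint is located. -/
def vertex : Endpoint Es Eh → V
  | Sum.inl e => G.init e
  | Sum.inr e => G.term e

/-- The edge to which an endpoint belongs. -/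
def edge : Endpoint Es Eh → Es ⊕ Eh
  | Sum.inl e => e
  | Sum.inr e => Sum.inl e

/-- The coordinate of an endpoint on its edge. -/
def coord : Endpoint Es Eh → ℝ
  | Sum.inl _ => 0
  | Sum.inr e => G.len e

/-- The sign of an endpoint in the balance condition. -/
def sign : Endpoint Es Eh → ℂ
  | Sum.inl _ => 1
  | Sum.inr _ => -1

section

variable [Fintype Es] [Fintype Eh]

/-- The Hilbert space `L²(G, ℂ²)`, the Hilbert sum of the spaces `L²(I_e, ℂ²)`. -/
abbrev L2 : Type _ := PiLp 2 (fun e : Es ⊕ Eh => L2On (G.interval e))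

/-- `f` is the family of continuous representatives (up to the endpoints) of `ψ`. -/
def IsContRep (ψ : G.L2) (f : Es ⊕ Eh → ℝ → Spinor) : Prop :=
  ∀ e, ContinuousOn (f e) (G.interval e) ∧ ψ e =ᵐ[volume.restrict (G.interval e)] f e

/-- Continuity of the first spinor component at every vertex. -/
def ContinuityCondition (f : Es ⊕ Eh → ℝ → Spinor) : Prop :=
  ∀ p q : Endpoint Es Eh, G.vertex p = G.vertex q →
    f (edge p) (G.coord p) 0 = f (edge q) (G.coord q) 0

open Classical in
/-- Balance of the second spinor component at every vertex. -/
def BalanceCondition (f : Es ⊕ Eh → ℝ → Spinor) : Prop :=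
  ∀ v : V, ∑ p : Endpoint Es Eh with G.vertex p = v, sign p * f (edge p) (G.coord p) 1 = 0

/-- The domain of the Dirac operator: spinors in `H¹(G, ℂ²)` whose boundary values (those of the
continuous representatives) satisfy the Kirchhoff-type vertex conditions. -/
def diracDomain : Submodule ℂ G.L2 where
  carrier := {ψ | (∀ e, ψ e ∈ H1On (G.interval e)) ∧
    ∃ f, G.IsContRep ψ f ∧ G.ContinuityCondition f ∧ G.BalanceCondition f}
  zero_mem' := by
    refine ⟨fun e => Submodule.zero_mem _, fun _ _ => 0, fun e => ⟨continuousOn_const, ?_⟩, ?_, ?_⟩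
    · exact Lp.coeFn_zero _ _ _
    · intro p q _
      rfl
    · intro v
      simp
  add_mem' := by
    rintro ψ χ ⟨h₁, f, hf, hfc, hfb⟩ ⟨h₂, g, hg, hgc, hgb⟩
    refine ⟨fun e => Submodule.add_mem _ (h₁ e) (h₂ e), fun e x => f e x + g e x,
      fun e => ⟨(hf e).1.add (hg e).1, ?_⟩, ?_, ?_⟩
    · exact (Lp.coeFn_add (ψ e) (χ e)).trans ((hf e).2.add (hg e).2)
    · intro p q h
      simp only [PiLp.add_apply, hfc p q h, hgc p q h]
    · intro v
      simp only [PiLp.add_apply, mul_add, Finset.sum_add_distrib, hfb v, hgb v, add_zero]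
  smul_mem' := by
    rintro a ψ ⟨h₁, f, hf, hfc, hfb⟩
    refine ⟨fun e => Submodule.smul_mem _ a (h₁ e), fun e x => a • f e x,
      fun e => ⟨(hf e).1.const_smul a, ?_⟩, ?_, ?_⟩
    · exact (Lp.coeFn_smul a (ψ e)).trans ((hf e).2.const_smul a)
    · intro p q h
      simp only [PiLp.smul_apply, hfc p q h]
    · intro v
      have := congrArg (a * ·) (hfb v)
      simp only [Finset.mul_sum, mul_zero] at this
      simpa only [PiLp.smul_apply, smul_eq_mul, mul_left_comm] using this

/-- The Dirac operator with Kirchhoff-type vertex conditions, acting on each edge as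
`ψ ↦ -i c σ₁ ψ' + m c² σ₃ ψ`. -/
def dirac (m c : ℝ) : G.L2 →ₗ.[ℂ] G.L2 where
  domain := G.diracDomain
  toFun :=
    { toFun := fun ψ => WithLp.toLp 2 fun e =>
        (-Complex.I * (c : ℂ)) • matrixAct (G.interval e) pauli1
            (weakDeriv (G.interval e) (G.volume_interval_diff e) ⟨ψ.1 e, ψ.2.1 e⟩)
          + ((m : ℂ) * (c : ℂ) ^ 2) • matrixAct (G.interval e) pauli3 (ψ.1 e)
      map_add' := by
        intro ψ χ
        ext1 e
        have h : (⟨(ψ + χ).1 e, (ψ + χ).2.1 e⟩ : H1On (G.interval e))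
            = ⟨ψ.1 e, ψ.2.1 e⟩ + ⟨χ.1 e, χ.2.1 e⟩ := rfl
        have h' : (ψ + χ).1 e = ψ.1 e + χ.1 e := rfl
        simp only [PiLp.add_apply]
        rw [h, h', map_add, map_add, map_add, smul_add, smul_add]
        abel
      map_smul' := by
        intro a ψ
        ext1 e
        have h : (⟨(a • ψ).1 e, (a • ψ).2.1 e⟩ : H1On (G.interval e))
            = a • ⟨ψ.1 e, ψ.2.1 e⟩ := rfl
        have h' : (a • ψ).1 e = a • ψ.1 e := rfl
        simp only [PiLp.smul_apply, RingHom.id_apply]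
        rw [h, h', map_smul, map_smul, map_smul, smul_comm _ a, smul_comm _ a, smul_add] }

end

end MetricGraph

end

noncomputable section

/-! Integration by parts on every edge turns `⟨Dψ, χ⟩ - ⟨ψ, Dχ⟩`, for `H¹` spinors, into a finite
boundary form: `-ic` times the sum over endpoints `p` of `sign p` times `conj ψ¹ * χ² + conj ψ² *
χ¹` at `p` (`sum_inner_diracExpr_sub`). At each vertex, continuity of first components and balance
of second components are conditions dual to each other under this form.

Symmetry: if both spinors satisfy the conditions, the constant first component factors out of each
vertex sum and balance kills what is left. With density this gives `D ≤ D*`.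

Maximality: let `χ` be in the domain of `D*` and `η = D*χ`. Testing against functions supported
inside one edge shows that `χ` is `H¹` there and that `η` is its Dirac expression; since `σ₁² = 1`,
the derivative can be solved for (`exists_hasWeakDeriv_of_inner_eq`). The boundary form then
vanishes for all `ψ` in the domain, and since their endpoint values are arbitrary subject to the
vertex conditions, `χ` must satisfy these too (`vertexConditions_of_sum_inner_eq`).

The analytic input is that an `H¹` function on an interval is a primitive of its weak derivative
(`HasWeakDeriv.exists_primitive`), which rests on the du Bois-Reymond lemma. -/

theorem AbsolutelyContinuousOnInterval.of_dist_le {X Y : Type*} [PseudoMetricSpace X]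
    [PseudoMetricSpace Y] {f : ℝ → X} {g : ℝ → Y} {a b : ℝ}
    (hg : AbsolutelyContinuousOnInterval g a b)
    (h : ∀ x ∈ Set.uIcc a b, ∀ y ∈ Set.uIcc a b, dist (f x) (f y) ≤ dist (g x) (g y)) :
    AbsolutelyContinuousOnInterval f a b := by
  unfold AbsolutelyContinuousOnInterval at hg ⊢
  refine squeeze_zero' ?_ ?_ hg
  · exact Filter.Eventually.of_forall fun _ => Finset.sum_nonneg fun _ _ => dist_nonneg
  · rw [Filter.eventually_inf_principal]
    filter_upwards with E hE
    exact Finset.sum_le_sum fun i hi => h _ (hE.1 i hi).1 _ (hE.1 i hi).2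

/-! ### Absolute continuity of primitives and integration by parts. -/

section Primitive

variable {𝕜 E : Type*} [RCLike 𝕜] [NormedAddCommGroup E] [NormedSpace ℝ E]

/-- Increments of the primitive are bounded by those of the real-valued primitive of `‖f‖`, so
absolute continuity is inherited from the latter. -/
theorem IntervalIntegrable.absolutelyContinuousOnInterval_primitive {f : ℝ → E} {a b : ℝ}
    (h : IntervalIntegrable f volume a b) :
    AbsolutelyContinuousOnInterval (fun x => ∫ t in a..x, f t) a b := by
  refine (h.norm.absolutelyContinuousOnInterval_intervalIntegral
    (c := a) Set.left_mem_uIcc).of_dist_le ?_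
  intro x hx y hy
  have hsub : ∀ z ∈ Set.uIcc a b, IntervalIntegrable f volume a z := fun z hz =>
    h.mono_set (Set.uIcc_subset_uIcc_left hz)
  rw [dist_comm, dist_comm (∫ v in a..x, ‖f v‖), dist_eq_norm, dist_eq_norm,
    intervalIntegral.integral_interval_sub_left (hsub y hy) (hsub x hx),
    intervalIntegral.integral_interval_sub_left (hsub y hy).norm (hsub x hx).norm]
  exact intervalIntegral.norm_integral_le_abs_integral_norm

variable [CompleteSpace E] [NormedSpace 𝕜 E] [IsScalarTower ℝ 𝕜 E]

/-- Integration by parts for primitives of integrable functions. -/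
theorem intervalIntegral.integral_smul_add_smul_of_primitive {f f' : ℝ → 𝕜} {g g' : ℝ → E}
    {a b : ℝ} (hf' : IntervalIntegrable f' volume a b) (hg' : IntervalIntegrable g' volume a b)
    (hf : ∀ x ∈ Set.uIcc a b, f x = f a + ∫ t in a..x, f' t)
    (hg : ∀ x ∈ Set.uIcc a b, g x = g a + ∫ t in a..x, g' t) :
    ∫ x in a..b, (f x • g' x + f' x • g x) = f b • g b - f a • g a := by
  have acf : AbsolutelyContinuousOnInterval f a b := by
    refine hf'.absolutelyContinuousOnInterval_primitive.of_dist_le fun x hx y hy => ?_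
    rw [hf x hx, hf y hy, dist_add_left]
  have acg : AbsolutelyContinuousOnInterval g a b := by
    refine hg'.absolutelyContinuousOnInterval_primitive.of_dist_le fun x hx y hy => ?_
    rw [hg x hx, hg y hy, dist_add_left]
  have hint : IntervalIntegrable (fun x => f x • g' x + f' x • g x) volume a b :=
    (hg'.continuousOn_smul acf.continuousOn).add (hf'.smul_continuousOn acg.continuousOn)
  -- The product minus the primitive of its expected derivative is absolutely continuous with zero
  -- derivative almost everywhere, hence constant; comparing its values at `a` and `b` gives the
  -- formula.
  have key := (acf.fun_smul acg).fun_sub hint.absolutelyContinuousOnInterval_primitive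
  -- The representations of `f` and `g` hold only on the closed interval, so two-sided derivatives
  -- are available only away from its endpoints.
  have hends : ∀ᵐ x : ℝ, x ∉ ({a, b} : Set ℝ) :=
    (Set.toFinite ({a, b} : Set ℝ)).measure_zero volume |> measure_eq_zero_iff_ae_notMem.1
  obtain ⟨C, hC⟩ := key.const_of_ae_hasDerivAt_zero (by
    filter_upwards [hf'.ae_hasDerivAt_integral, hg'.ae_hasDerivAt_integral,
      hint.ae_hasDerivAt_integral, hends] with x h1 h2 h3 hne hx
    have hnhds : Set.uIcc a b ∈ nhds x := by
      simp only [Set.mem_insert_iff, Set.mem_singleton_iff, not_or] at hne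
      rw [Set.mem_uIcc] at hx
      rcases hx with hx | hx
      · rw [Set.uIcc_of_le (hx.1.trans hx.2)]
        exact Icc_mem_nhds (lt_of_le_of_ne hx.1 (Ne.symm hne.1)) (lt_of_le_of_ne hx.2 hne.2)
      · rw [Set.uIcc_of_ge (hx.1.trans hx.2)]
        exact Icc_mem_nhds (lt_of_le_of_ne hx.1 (Ne.symm hne.2)) (lt_of_le_of_ne hx.2 hne.1)
    have df : HasDerivAt f (f' x) x :=
      ((h1 hx a Set.left_mem_uIcc).const_add (f a)).congr_of_eventuallyEq
        (Filter.mem_of_superset hnhds hf)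
    have dg : HasDerivAt g (g' x) x :=
      ((h2 hx a Set.left_mem_uIcc).const_add (g a)).congr_of_eventuallyEq
        (Filter.mem_of_superset hnhds hg)
    have := (df.smul dg).sub (h3 hx a Set.left_mem_uIcc)
    rwa [sub_self] at this)
  have ha := hC a Set.left_mem_uIcc
  have hb := hC b Set.right_mem_uIcc
  simp only [intervalIntegral.integral_same, sub_zero] at ha
  rw [← ha] at hb
  rw [← hb]
  abel

end Primitive

/-! ### The du Bois-Reymond lemma. -/

section DuBoisReymond

/-- A smooth compactly supported function of integral zero has a compactly supported primitive. -/
theorem exists_contDiff_hasCompactSupport_deriv_eq {U : Set ℝ} (hU : U.OrdConnected)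
    (hne : U.Nonempty) {h : ℝ → ℝ} (hh : ContDiff ℝ ∞ h) (hc : HasCompactSupport h)
    (hs : tsupport h ⊆ U) (h0 : ∫ x, h x = 0) :
    ∃ φ : ℝ → ℝ, ContDiff ℝ ∞ φ ∧ HasCompactSupport φ ∧ tsupport φ ⊆ U ∧ deriv φ = h := by
  -- Both ends are taken in `U` itself, so that order-connectedness places the support of the
  -- primitive, contained in `[a, b]`, inside `U`.
  obtain ⟨a, b, ha, hb, hab⟩ : ∃ a b : ℝ, a ∈ U ∧ b ∈ U ∧ tsupport h ⊆ Set.Icc a b := by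
    by_cases hK : (tsupport h).Nonempty
    · exact ⟨sInf (tsupport h), sSup (tsupport h), hs (hc.isCompact.sInf_mem hK),
        hs (hc.isCompact.sSup_mem hK), fun x hx =>
        ⟨csInf_le hc.isCompact.bddBelow hx, le_csSup hc.isCompact.bddAbove hx⟩⟩
    · obtain ⟨x, hx⟩ := hne
      rw [Set.not_nonempty_iff_eq_empty] at hK
      exact ⟨x, x, hx, hx, hK ▸ Set.empty_subset _⟩
  have hzero : ∀ x, x ∉ Set.Icc a b → h x = 0 := fun x hx =>
    image_eq_zero_of_notMem_tsupport fun h' => hx (hab h')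
  have hd : ∀ x, HasDerivAt (fun x => ∫ t in a..x, h t) (h x) x := fun x =>
    intervalIntegral.integral_hasDerivAt_right (hh.continuous.intervalIntegrable _ _)
      (hh.continuous.stronglyMeasurableAtFilter _ _) hh.continuous.continuousAt
  have hderiv : deriv (fun x => ∫ t in a..x, h t) = h := funext fun x => (hd x).deriv
  have hsupp : Function.support (fun x => ∫ t in a..x, h t) ⊆ Set.Icc a b := by
    intro x hx
    by_contra hxI
    refine hx ?_
    rcases lt_or_ge x a with hxa | hxa
    · refine intervalIntegral.integral_zero_ae (Filter.Eventually.of_forall fun t ht => ?_)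
      rw [Set.uIoc_of_ge hxa.le] at ht
      -- The point `a` may lie in the support of `h`; there `h` vanishes as its limit from the left.
      by_cases hta : t = a
      · subst hta
        refine tendsto_nhds_unique (hh.continuous.tendsto t |>.mono_left nhdsWithin_le_nhds)
          (tendsto_const_nhds.congr' ?_ : Filter.Tendsto h (nhdsWithin t (Set.Iio t)) _)
        filter_upwards [self_mem_nhdsWithin] with s hs'
        exact (hzero s fun h' => not_lt.2 h'.1 hs').symm
      · exact hzero t fun h' => hta (le_antisymm ht.2 h'.1)
    · have hbx : b < x := by
        by_contra! hle
        exact hxI ⟨hxa, hle⟩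
      have : ∫ t in a..x, h t = ∫ t, h t := by
        rw [intervalIntegral.integral_of_le hxa, ← integral_Icc_eq_integral_Ioc]
        refine setIntegral_eq_integral_of_forall_compl_eq_zero fun t ht => hzero t fun h' => ?_
        exact ht ⟨h'.1, h'.2.trans hbx.le⟩
      exact this.trans h0
  have hts : tsupport (fun x => ∫ t in a..x, h t) ⊆ Set.Icc a b :=
    closure_minimal hsupp isClosed_Icc
  refine ⟨fun x => ∫ t in a..x, h t, ?_, ?_, hts.trans (hU.out ha hb), hderiv⟩
  · rw [contDiff_infty_iff_deriv, hderiv]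
    exact ⟨fun x => (hd x).differentiableAt, hh⟩
  · exact HasCompactSupport.of_support_subset_isCompact isCompact_Icc hsupp

variable {E : Type*} [NormedAddCommGroup E] [NormedSpace ℝ E] [CompleteSpace E]

/-- The lemma of du Bois-Reymond: a function with zero weak derivative is constant. -/
theorem exists_ae_eq_const_of_integral_deriv_smul_eq_zero {U : Set ℝ} (hU : IsOpen U)
    (hc : U.OrdConnected) (hne : U.Nonempty) {g : ℝ → E}
    (hg : LocallyIntegrable g (volume.restrict U))
    (h : ∀ φ : ℝ → ℝ, ContDiff ℝ ∞ φ → HasCompactSupport φ → tsupport φ ⊆ U →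
      ∫ x in U, deriv φ x • g x = 0) :
    ∃ C, ∀ᵐ x ∂(volume.restrict U), g x = C := by
  obtain ⟨x₀, hx₀⟩ := hne
  obtain ⟨r, hr, hrU⟩ := Metric.nhds_basis_closedBall.mem_iff.1 (hU.mem_nhds hx₀)
  let β : ContDiffBump x₀ := ⟨r / 2, r, by positivity, by linarith⟩
  let θ : ℝ → ℝ := β.normed volume
  have hθ : ContDiff ℝ ∞ θ := β.contDiff_normed
  have hθc : HasCompactSupport θ := β.hasCompactSupport_normed
  have hθs : tsupport θ ⊆ U := by
    rw [β.tsupport_normed_eq]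
    exact hrU
  have hθ1 : ∫ x, θ x = 1 := β.integral_normed
  have int : ∀ ψ : ℝ → ℝ, Continuous ψ → HasCompactSupport ψ →
      Integrable (fun x => ψ x • g x) (volume.restrict U) := fun ψ h1 h2 =>
    hg.integrable_smul_left_of_hasCompactSupport h1 h2
  have set_eq : ∀ (ψ : ℝ → ℝ) (k : ℝ → E), tsupport ψ ⊆ U →
      ∫ x in U, ψ x • k x = ∫ x, ψ x • k x := fun ψ k hψ =>
    setIntegral_eq_integral_of_forall_compl_eq_zero fun x hx => by
      rw [image_eq_zero_of_notMem_tsupport fun h' => hx (hψ h'), zero_smul]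
  -- The constant is the mean of `g` against the bump `θ` of integral one.
  set C : E := ∫ x in U, θ x • g x with hC
  refine ⟨C, ?_⟩
  rw [ae_restrict_iff' hU.measurableSet]
  have hgC : LocallyIntegrable (fun x => g x - C) (volume.restrict U) :=
    hg.sub (locallyIntegrable_const C)
  -- For any test function `ψ`, the function `ψ - (∫ ψ) θ` has integral zero, hence is the
  -- derivative of a test function; the hypothesis then reads `∫ ψ g = (∫ ψ) C`.
  have key := hU.ae_eq_zero_of_integral_contDiff_smul_eq_zero
    (locallyIntegrableOn_of_locallyIntegrable_restrict hgC) (fun ψ hψ hψc hψs => by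
      rw [← set_eq ψ _ hψs]
      obtain ⟨φ, h1, h2, h3, h4⟩ := exists_contDiff_hasCompactSupport_deriv_eq hc ⟨x₀, hx₀⟩
        (h := fun x => ψ x - (∫ t, ψ t) * θ x) (hψ.sub (contDiff_const.mul hθ))
        (hψc.sub (hθc.mul_left))
        ((tsupport_sub _ _).trans (Set.union_subset hψs
          ((tsupport_mul_subset_right).trans hθs)))
        (by
          rw [integral_sub (hψ.continuous.integrable_of_hasCompactSupport hψc)
            ((hθ.continuous.integrable_of_hasCompactSupport hθc).const_mul _),
            integral_const_mul, hθ1, mul_one, sub_self])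
      have h5 := h φ h1 h2 h3
      simp only [h4, sub_smul, mul_smul] at h5
      rw [integral_sub (int ψ hψ.continuous hψc) ((int θ hθ.continuous hθc).fun_smul (∫ t, ψ t)),
        integral_smul, ← hC, sub_eq_zero] at h5
      simp only [smul_sub]
      rw [integral_sub (int ψ hψ.continuous hψc)
        ((hψ.continuous.integrable_of_hasCompactSupport hψc).restrict.smul_const C), h5,
        set_eq ψ (fun _ => C) hψs, integral_smul_const, sub_self])
  filter_upwards [key] with x hx hxU
  exact sub_eq_zero.1 (hx hxU)

end DuBoisReymond

open scoped ComplexConjugate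

/-! ### Primitives as weak antiderivatives. -/

section

theorem MeasureTheory.LocallyIntegrable.intervalIntegrable {E : Type*} [NormedAddCommGroup E]
    {f : ℝ → E} (hf : LocallyIntegrable f) {a b : ℝ} : IntervalIntegrable f volume a b :=
  intervalIntegrable_iff.mpr
    ((hf.integrableOn_isCompact isCompact_uIcc).mono_set Set.uIoc_subset_uIcc)

variable {E : Type*} [NormedAddCommGroup E] [NormedSpace ℝ E] [CompleteSpace E]

theorem integral_deriv_smul_primitive {V : ℝ → E} (hV : LocallyIntegrable V) {φ : ℝ → ℝ}
    (hφ : ContDiff ℝ ∞ φ) (hc : HasCompactSupport φ) :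
    ∫ x, deriv φ x • (∫ t in (0 : ℝ)..x, V t) = - ∫ x, φ x • V x := by
  have hii : ∀ a b, IntervalIntegrable V volume a b := fun a b =>
    hV.intervalIntegrable
  have hd : Continuous (deriv φ) := hφ.continuous_deriv (by simp)
  have hF : Continuous fun x => ∫ t in (0 : ℝ)..x, V t :=
    intervalIntegral.continuous_primitive hii 0
  obtain ⟨R, hR⟩ := hc.isCompact.isBounded.subset_closedBall 0
  -- The margin `1` puts both ends of the interval strictly outside the support, so the boundary
  -- terms vanish.
  have hzero : ∀ x, x ∉ Set.Ioc (-(|R| + 1)) (|R| + 1) → x ∉ tsupport φ := fun x hx h => by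
    have := hR h
    rw [Real.closedBall_eq_Icc] at this
    exact hx ⟨by linarith [this.1, le_abs_self R], by linarith [this.2, le_abs_self R]⟩
  have hφ0 : ∀ x, x ∉ Set.Ioc (-(|R| + 1)) (|R| + 1) → φ x = 0 := fun x hx =>
    image_eq_zero_of_notMem_tsupport (hzero x hx)
  have hle : -(|R| + 1) ≤ |R| + 1 := by linarith [abs_nonneg R]
  have hb : φ (|R| + 1) = 0 := image_eq_zero_of_notMem_tsupport fun h => by
    have := hR h
    rw [Real.closedBall_eq_Icc] at this
    linarith [this.2, le_abs_self R]
  have h1 := intervalIntegral.integral_smul_add_smul_of_primitive (𝕜 := ℝ) (f := φ)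
    (f' := deriv φ) (g := fun x => ∫ t in (0 : ℝ)..x, V t) (g' := V)
    (a := -(|R| + 1)) (b := |R| + 1) (hd.intervalIntegrable _ _) (hii _ _)
    (fun x _ => by
      rw [intervalIntegral.integral_deriv_eq_sub
        (fun y _ => hφ.differentiable (by simp) y) (hd.intervalIntegrable _ _)]
      ring)
    (fun x _ => (intervalIntegral.integral_add_adjacent_intervals (hii _ _) (hii _ _)).symm)
  rw [hb, hφ0 (-(|R| + 1)) (fun h => lt_irrefl _ h.1), zero_smul, zero_smul, sub_zero,
    intervalIntegral.integral_of_le hle,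
    setIntegral_eq_integral_of_forall_compl_eq_zero, integral_add, add_eq_zero_iff_eq_neg] at h1
  · rw [h1, neg_neg]
  · exact hV.integrable_smul_left_of_hasCompactSupport hφ.continuous hc
  · exact (hF.locallyIntegrable).integrable_smul_left_of_hasCompactSupport hd hc.deriv
  · intro x hx
    have h2 : deriv φ x = 0 :=
      image_eq_zero_of_notMem_tsupport fun h => hzero x hx (closure_minimal
        support_deriv_subset (isClosed_tsupport φ) h)
    rw [hφ0 x hx, h2, zero_smul, zero_smul, add_zero]

end

/-! ### Continuous representatives and boundary values of `H¹` functions. -/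

section Representative

variable {I : Set ℝ}

theorem L2On.locallyIntegrable_indicator (hI : MeasurableSet I) (v : L2On I) :
    LocallyIntegrable (I.indicator v) :=
  ((memLp_indicator_iff_restrict hI).2 (Lp.memLp v)).locallyIntegrable (by norm_num)

theorem L2On.locallyIntegrable_interior (v : L2On I) :
    LocallyIntegrable v (volume.restrict (interior I)) :=
  ((Lp.memLp v).mono_measure (Measure.restrict_mono interior_subset le_rfl)).locallyIntegrable
    (by norm_num)

theorem setIntegral_smul_eq_of_tsupport_subset {E : Type*} [NormedAddCommGroup E]
    [NormedSpace ℝ E] {φ : ℝ → ℝ} {s : Set ℝ} (hφ : tsupport φ ⊆ s) (k : ℝ → E) :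
    ∫ x in s, φ x • k x = ∫ x, φ x • k x :=
  setIntegral_eq_integral_of_forall_compl_eq_zero fun x hx => by
    rw [image_eq_zero_of_notMem_tsupport fun h' => hx (hφ h'), zero_smul]

/-- The continuous representative of an `H¹` function, as a primitive of the weak derivative. -/
theorem HasWeakDeriv.exists_primitive (hI : I.OrdConnected) (hne : (interior I).Nonempty)
    (hvol : volume (I \ interior I) = 0) {u v : L2On I} (h : HasWeakDeriv I u v) :
    ∃ f : ℝ → Spinor, Continuous f ∧ u =ᵐ[volume.restrict I] f ∧
      ∀ x, f x = f 0 + ∫ t in (0 : ℝ)..x, I.indicator v t := by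
  have hV := L2On.locallyIntegrable_indicator hI.measurableSet v
  have hF : Continuous fun x => ∫ t in (0 : ℝ)..x, I.indicator v t :=
    intervalIntegral.continuous_primitive (fun _ _ => hV.intervalIntegrable) 0
  have hres : volume.restrict I = volume.restrict (interior I) :=
    (Measure.restrict_congr_set ((LE.le.eventuallyLE interior_subset).antisymm
      (ae_le_set.2 hvol))).symm
  -- Subtracting from `u` a primitive of the zero extension of `v` leaves a function with zero weak
  -- derivative.
  obtain ⟨C, hC⟩ := exists_ae_eq_const_of_integral_deriv_smul_eq_zero isOpen_interior
    hI.interior hne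
    (g := fun x => u x - ∫ t in (0 : ℝ)..x, I.indicator v t)
    (u.locallyIntegrable_interior.sub hF.locallyIntegrable) (by
      intro φ hφ hc hs
      have hds : tsupport (deriv φ) ⊆ interior I := (tsupport_deriv_subset).trans hs
      have hd : Continuous (deriv φ) := hφ.continuous_deriv (by simp)
      simp only [smul_sub]
      rw [integral_sub (u.locallyIntegrable_interior.integrable_smul_left_of_hasCompactSupport
          hd hc.deriv)
        (hF.locallyIntegrable.integrable_smul_left_of_hasCompactSupport hd hc.deriv),
        setIntegral_smul_eq_of_tsupport_subset hds
          (fun x => ∫ t in (0 : ℝ)..x, I.indicator v t),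
        integral_deriv_smul_primitive hV hφ hc, ← hres, h φ hφ hc hs, sub_neg_eq_add,
        ← setIntegral_smul_eq_of_tsupport_subset (hs.trans interior_subset) (I.indicator v)]
      have hcongr : ∫ x in I, φ x • I.indicator v x = ∫ x in I, φ x • v x :=
        setIntegral_congr_fun hI.measurableSet fun x hx => by
          simp only [Set.indicator_of_mem hx]
      rw [hcongr, neg_add_cancel])
  refine ⟨fun x => C + ∫ t in (0 : ℝ)..x, I.indicator v t, by fun_prop, ?_, fun x => by simp⟩
  refine hres.le.absolutelyContinuous.ae_le ?_
  filter_upwards [hC] with x hx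
  rw [← hx, sub_add_cancel]

theorem L2On.integrable_mul_conj (u w : L2On I) (i j : Fin 2) :
    Integrable (fun x => conj (u x i) * w x j) (volume.restrict I) := by
  have hp : ∀ (a : L2On I) (k : Fin 2), MemLp (fun x => a x k) 2 (volume.restrict I) :=
    fun a k => (EuclideanSpace.proj (𝕜 := ℂ) k).comp_memLp' (Lp.memLp a)
  exact ((hp u i).star).integrable_mul (hp w j)

theorem primitive_apply {f V : ℝ → Spinor} (hV : LocallyIntegrable V)
    (hf : ∀ x, f x = f 0 + ∫ t in (0 : ℝ)..x, V t) (i : Fin 2) (x : ℝ) :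
    f x i = f 0 i + ∫ t in (0 : ℝ)..x, V t i := by
  have := (EuclideanSpace.proj (𝕜 := ℂ) i).restrictScalars ℝ |>.intervalIntegral_comp_comm
    (hV.intervalIntegrable (a := 0) (b := x))
  simp only [ContinuousLinearMap.coe_restrictScalars', EuclideanSpace.coe_proj] at this
  rw [this, hf x]
  simp

theorem LocallyIntegrable.apply_spinor {V : ℝ → Spinor} (hV : LocallyIntegrable V) (i : Fin 2)
    (a b : ℝ) : IntervalIntegrable (fun x => V x i) volume a b := by
  have h := hV.intervalIntegrable (a := a) (b := b)
  exact ⟨(EuclideanSpace.proj (𝕜 := ℂ) i).integrable_comp h.1,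
    (EuclideanSpace.proj (𝕜 := ℂ) i).integrable_comp h.2⟩

theorem intervalIntegral_conj_mul_of_primitive {f V g W : ℝ → Spinor}
    (hV : LocallyIntegrable V) (hW : LocallyIntegrable W)
    (hf : ∀ x, f x = f 0 + ∫ t in (0 : ℝ)..x, V t)
    (hg : ∀ x, g x = g 0 + ∫ t in (0 : ℝ)..x, W t) (i j : Fin 2) (b : ℝ) :
    ∫ x in (0 : ℝ)..b, (conj (f x i) * W x j + conj (V x i) * g x j)
      = conj (f b i) * g b j - conj (f 0 i) * g 0 j := by
  have hVi := LocallyIntegrable.apply_spinor hV i 0 b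
  have hVc : IntervalIntegrable (fun x => conj (V x i)) volume 0 b :=
    ⟨Complex.conjCLE.toContinuousLinearMap.integrable_comp hVi.1,
      Complex.conjCLE.toContinuousLinearMap.integrable_comp hVi.2⟩
  refine intervalIntegral.integral_smul_add_smul_of_primitive (𝕜 := ℂ)
    (f := fun x => conj (f x i)) (g := fun x => g x j) hVc
    (LocallyIntegrable.apply_spinor hW j 0 b) (fun x _ => ?_)
    (fun x _ => primitive_apply hW hg j x)
  have := Complex.conjCLE.toContinuousLinearMap.intervalIntegral_comp_comm
    (LocallyIntegrable.apply_spinor hV i 0 x)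
  simp only [ContinuousLinearEquiv.coe_coe, Complex.conjCLE_apply] at this
  rw [this, primitive_apply hV hf i x, map_add]

/-- Integration by parts on the initial part `[0, b]` of an interval. -/
theorem HasWeakDeriv.exists_primitive_pair (hI : I.OrdConnected) (hne : (interior I).Nonempty)
    (hvol : volume (I \ interior I) = 0) (h0 : 0 ∈ I) {u v w z : L2On I}
    (huv : HasWeakDeriv I u v) (hwz : HasWeakDeriv I w z) :
    ∃ f g : ℝ → Spinor, Continuous f ∧ Continuous g ∧ u =ᵐ[volume.restrict I] f ∧
      w =ᵐ[volume.restrict I] g ∧ ∀ i j, ∀ b ∈ I, 0 ≤ b →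
        ∫ x in (0 : ℝ)..b, (conj (u x i) * z x j + conj (v x i) * w x j)
          = conj (f b i) * g b j - conj (f 0 i) * g 0 j := by
  obtain ⟨f, hf, huf, hfv⟩ := huv.exists_primitive hI hne hvol
  obtain ⟨g, hg, hwg, hgz⟩ := hwz.exists_primitive hI hne hvol
  refine ⟨f, g, hf, hg, huf, hwg, fun i j b hb hb0 => ?_⟩
  rw [← intervalIntegral_conj_mul_of_primitive
    (L2On.locallyIntegrable_indicator hI.measurableSet v)
    (L2On.locallyIntegrable_indicator hI.measurableSet z) hfv hgz i j b]
  refine intervalIntegral.integral_congr_ae ?_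
  rw [Filter.EventuallyEq, ae_restrict_iff' hI.measurableSet] at huf hwg
  filter_upwards [huf, hwg] with x h1 h2 hx
  rw [Set.uIoc_of_le hb0] at hx
  have hxI : x ∈ I := hI.out h0 hb ⟨hx.1.le, hx.2⟩
  rw [h1 hxI, h2 hxI, Set.indicator_of_mem hxI, Set.indicator_of_mem hxI]

theorem setIntegral_Icc_conj_mul_of_hasWeakDeriv {ℓ : ℝ} (hℓ : 0 < ℓ)
    {u v w z : L2On (Set.Icc 0 ℓ)}
    (huv : HasWeakDeriv _ u v) (hwz : HasWeakDeriv _ w z) {f g : ℝ → Spinor}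
    (hf : ContinuousOn f (Set.Icc 0 ℓ)) (hg : ContinuousOn g (Set.Icc 0 ℓ))
    (huf : u =ᵐ[volume.restrict (Set.Icc 0 ℓ)] f) (hwg : w =ᵐ[volume.restrict (Set.Icc 0 ℓ)] g)
    (i j : Fin 2) :
    ∫ x in Set.Icc 0 ℓ, (conj (u x i) * z x j + conj (v x i) * w x j)
      = conj (f ℓ i) * g ℓ j - conj (f 0 i) * g 0 j := by
  have hcl : Set.Icc 0 ℓ ⊆ closure (interior (Set.Icc 0 ℓ)) := by
    rw [interior_Icc, closure_Ioo hℓ.ne]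
  have h0 : (0 : ℝ) ∈ Set.Icc 0 ℓ := ⟨le_rfl, hℓ.le⟩
  have h1 : ℓ ∈ Set.Icc 0 ℓ := ⟨hℓ.le, le_rfl⟩
  obtain ⟨f', g', hf', hg', huf', hwg', key⟩ := huv.exists_primitive_pair Set.ordConnected_Icc
    (by rw [interior_Icc]; exact Set.nonempty_Ioo.2 hℓ)
    (by
      rw [interior_Icc, Set.Icc_sdiff_Ioo_same hℓ.le]
      exact (Set.toFinite _).measure_zero _) h0 hwz
  -- Continuous functions that agree almost everywhere on an interval contained in the closure of
  -- its interior agree at its endpoints too, so the given representatives have the boundary values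
  -- of the constructed ones.
  have ef := Measure.eqOn_of_ae_eq (huf.symm.trans huf') hf hf'.continuousOn hcl
  have eg := Measure.eqOn_of_ae_eq (hwg.symm.trans hwg') hg hg'.continuousOn hcl
  rw [ef h0, ef h1, eg h0, eg h1, ← key i j ℓ h1 hℓ.le, integral_Icc_eq_integral_Ioc,
    intervalIntegral.integral_of_le hℓ.le]

/-- There is no boundary term at infinity: the product of the representatives has a limit because
its derivative is integrable, and the limit is zero because the product itself is integrable. -/
theorem setIntegral_Ici_conj_mul_of_hasWeakDeriv {u v w z : L2On (Set.Ici 0)}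
    (huv : HasWeakDeriv _ u v) (hwz : HasWeakDeriv _ w z) {f g : ℝ → Spinor}
    (hf : ContinuousOn f (Set.Ici 0)) (hg : ContinuousOn g (Set.Ici 0))
    (huf : u =ᵐ[volume.restrict (Set.Ici 0)] f) (hwg : w =ᵐ[volume.restrict (Set.Ici 0)] g)
    (i j : Fin 2) :
    ∫ x in Set.Ici (0 : ℝ), (conj (u x i) * z x j + conj (v x i) * w x j)
      = - (conj (f 0 i) * g 0 j) := by
  have hcl : Set.Ici (0 : ℝ) ⊆ closure (interior (Set.Ici 0)) := by
    rw [interior_Ici, closure_Ioi]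
  have h0 : (0 : ℝ) ∈ Set.Ici (0 : ℝ) := Set.self_mem_Ici
  obtain ⟨f', g', hf', hg', huf', hwg', key⟩ := huv.exists_primitive_pair Set.ordConnected_Ici
    (by rw [interior_Ici]; exact Set.nonempty_Ioi)
    (by
      rw [interior_Ici, Set.Ici_sdiff_Ioi_same]
      exact (Set.toFinite _).measure_zero _) h0 hwz
  rw [Measure.eqOn_of_ae_eq (huf.symm.trans huf') hf hf'.continuousOn hcl h0,
    Measure.eqOn_of_ae_eq (hwg.symm.trans hwg') hg hg'.continuousOn hcl h0]
  have hint : IntegrableOn (fun x => conj (u x i) * z x j + conj (v x i) * w x j) (Set.Ioi 0) :=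
    ((u.integrable_mul_conj z i j).add (v.integrable_mul_conj w i j)).mono_measure
      (Measure.restrict_mono Set.Ioi_subset_Ici_self le_rfl)
  have hlim : Filter.Tendsto (fun b => conj (f' b i) * g' b j) Filter.atTop
      (nhds ((∫ x in Set.Ioi (0 : ℝ), (conj (u x i) * z x j + conj (v x i) * w x j))
        + conj (f' 0 i) * g' 0 j)) := by
    refine ((intervalIntegral_tendsto_integral_Ioi 0 hint Filter.tendsto_id).add_const
      (conj (f' 0 i) * g' 0 j)).congr' ?_
    filter_upwards [Filter.eventually_ge_atTop 0] with b hb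
    rw [id, key i j b hb hb, sub_add_cancel]
  have hprod : IntegrableOn (fun b => conj (f' b i) * g' b j) (Set.Ici 0) := by
    refine (u.integrable_mul_conj w i j).congr ?_
    filter_upwards [huf', hwg'] with x h1 h2
    rw [h1, h2]
  have hzero := IntegrableAtFilter.eq_zero_of_tendsto
    (⟨Set.Ici 0, Filter.Ici_mem_atTop 0, hprod⟩ : IntegrableAtFilter _ Filter.atTop volume)
    (fun s hs => by
      obtain ⟨a, ha⟩ := Filter.mem_atTop_sets.1 hs
      exact top_unique (Real.volume_Ici (a := a) ▸ measure_mono ha)) hlim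
  rw [integral_Ici_eq_integral_Ioi]
  exact eq_neg_of_add_eq_zero_left hzero

end Representative

/-! ### Smooth test spinors. -/

section TestFunction

variable {I : Set ℝ} {φ : ℝ → ℝ}

theorem memLp_smul_spinor (I : Set ℝ) (hφ : Continuous φ) (hc : HasCompactSupport φ)
    (s : Spinor) : MemLp (fun x => φ x • s) 2 (volume.restrict I) :=
  (hφ.smul continuous_const).memLp_of_hasCompactSupport hc.smul_right

/-- The element of `L²(I, ℂ²)` given by a continuous compactly supported scalar function times
a constant spinor. -/
def testL2 (I : Set ℝ) (hφ : Continuous φ) (hc : HasCompactSupport φ) (s : Spinor) : L2On I :=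
  (memLp_smul_spinor I hφ hc s).toLp _

theorem coeFn_testL2 (hφ : Continuous φ) (hc : HasCompactSupport φ) (s : Spinor) :
    testL2 I hφ hc s =ᵐ[volume.restrict I] fun x => φ x • s :=
  MemLp.coeFn_toLp _

/-- `φ` may be nonzero at the ends of `I`: in the defining identity only `θ` has to be supported
inside. This is what allows prescribed endpoint values later. -/
theorem hasWeakDeriv_testL2 (hφ : ContDiff ℝ ∞ φ) (hc : HasCompactSupport φ) (s : Spinor) :
    HasWeakDeriv I (testL2 I hφ.continuous hc s)
      (testL2 I (hφ.continuous_deriv (by simp)) hc.deriv s) := by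
  intro θ hθ hθc hθI
  have hθd : Continuous (deriv θ) := hθ.continuous_deriv (by simp)
  have hφd : Continuous (deriv φ) := hφ.continuous_deriv (by simp)
  have hsI : tsupport θ ⊆ I := hθI.trans interior_subset
  have e₁ : ∫ x in I, deriv θ x • testL2 I hφ.continuous hc s x
      = ∫ x, deriv θ x • (φ x • s) := by
    rw [← setIntegral_smul_eq_of_tsupport_subset (tsupport_deriv_subset.trans hsI)]
    refine integral_congr_ae ?_
    filter_upwards [coeFn_testL2 hφ.continuous hc s] with x hx
    rw [hx]
  have e₂ : ∫ x in I, θ x • testL2 I hφd hc.deriv s x = ∫ x, θ x • (deriv φ x • s) := by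
    rw [← setIntegral_smul_eq_of_tsupport_subset hsI]
    refine integral_congr_ae ?_
    filter_upwards [coeFn_testL2 hφd hc.deriv s] with x hx
    rw [hx]
  rw [e₁, e₂]
  simp only [smul_smul, integral_smul_const]
  rw [← neg_smul]
  congr 1
  rw [integral_mul_deriv_eq_deriv_mul_of_integrable
    (fun x _ => (hθ.differentiable (by simp) x).hasDerivAt)
    (fun x _ => (hφ.differentiable (by simp) x).hasDerivAt)
    ((hθ.continuous.mul hφd).integrable_of_hasCompactSupport hθc.mul_right)
    ((hθd.mul hφ.continuous).integrable_of_hasCompactSupport hc.mul_left)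
    ((hθ.continuous.mul hφ.continuous).integrable_of_hasCompactSupport hθc.mul_right), neg_neg]

/-- Letting `s` vary, inner products with test spinors determine the vector integrals that occur in
the definition of the weak derivative. -/
theorem inner_testL2 (hφ : Continuous φ) (hc : HasCompactSupport φ) (s : Spinor) (g : L2On I) :
    inner ℂ g (testL2 I hφ hc s) = inner ℂ (∫ x in I, φ x • g x) s := by
  rw [L2.inner_def, ← inner_conj_symm, ← integral_inner (integrable_smul_L2On hφ hc g),
    ← integral_conj]
  refine integral_congr_ae ?_
  filter_upwards [coeFn_testL2 hφ hc s] with x hx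
  rw [hx, inner_conj_symm, ← Complex.coe_smul, ← Complex.coe_smul, inner_smul_left,
    inner_smul_right, Complex.conj_ofReal]

end TestFunction

/-! ### Pauli matrices and the Dirac expression. -/

section MatrixAct

variable {I : Set ℝ}

theorem coeFn_matrixAct (A : Matrix (Fin 2) (Fin 2) ℂ) (u : L2On I) :
    matrixAct I A u =ᵐ[volume.restrict I]
      fun x => Matrix.toEuclideanCLM (n := Fin 2) (𝕜 := ℂ) A (u x) :=
  ContinuousLinearMap.coeFn_compLp _ _

theorem matrixAct_matrixAct (A B : Matrix (Fin 2) (Fin 2) ℂ) (u : L2On I) :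
    matrixAct I A (matrixAct I B u) = matrixAct I (A * B) u := by
  refine Lp.ext ?_
  filter_upwards [coeFn_matrixAct A (matrixAct I B u), coeFn_matrixAct B u,
    coeFn_matrixAct (A * B) u] with x h1 h2 h3
  rw [h1, h2, h3, map_mul]
  rfl

theorem matrixAct_one (u : L2On I) : matrixAct I 1 u = u := by
  refine Lp.ext ?_
  filter_upwards [coeFn_matrixAct 1 u] with x h1
  rw [h1, map_one]
  rfl

theorem inner_matrixAct_left {A : Matrix (Fin 2) (Fin 2) ℂ} (hA : A.IsHermitian) (u w : L2On I) :
    inner ℂ (matrixAct I A u) w = inner ℂ u (matrixAct I A w) := by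
  rw [L2.inner_def, L2.inner_def]
  refine integral_congr_ae ?_
  filter_upwards [coeFn_matrixAct A u, coeFn_matrixAct A w] with x h1 h2
  have h : ContinuousLinearMap.adjoint (Matrix.toEuclideanCLM (n := Fin 2) (𝕜 := ℂ) A)
      = Matrix.toEuclideanCLM (n := Fin 2) (𝕜 := ℂ) A := by
    rw [← ContinuousLinearMap.star_eq_adjoint, ← map_star, Matrix.star_eq_conjTranspose, hA.eq]
  rw [h1, h2, ← ContinuousLinearMap.adjoint_inner_left, h]

theorem pauli1_isHermitian : pauli1.IsHermitian := by
  ext i j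
  fin_cases i <;> fin_cases j <;> simp [pauli1]

theorem pauli3_isHermitian : pauli3.IsHermitian := by
  ext i j
  fin_cases i <;> fin_cases j <;> simp [pauli3]

theorem pauli1_mul_self : pauli1 * pauli1 = 1 := by
  ext i j
  fin_cases i <;> fin_cases j <;> simp [pauli1]

theorem HasWeakDeriv.matrixAct (A : Matrix (Fin 2) (Fin 2) ℂ) {u v : L2On I}
    (h : HasWeakDeriv I u v) : HasWeakDeriv I (matrixAct I A u) (matrixAct I A v) := by
  have key : ∀ (θ : ℝ → ℝ) (w : L2On I), Continuous θ → HasCompactSupport θ →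
      ∫ x in I, θ x • _root_.matrixAct I A w x
        = Matrix.toEuclideanCLM (n := Fin 2) (𝕜 := ℂ) A (∫ x in I, θ x • w x) := by
    intro θ w hθ hc
    rw [← ContinuousLinearMap.integral_comp_comm _ (integrable_smul_L2On hθ hc w)]
    refine integral_congr_ae ?_
    filter_upwards [coeFn_matrixAct A w] with x hx
    rw [hx, ContinuousLinearMap.map_smul_of_tower]
  intro φ hφ hc hI
  rw [key _ _ (hφ.continuous_deriv (by simp)) hc.deriv, key _ _ hφ.continuous hc,
    h φ hφ hc hI, map_neg]

theorem inner_matrixAct_pauli1 (u w : L2On I) :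
    inner ℂ (matrixAct I pauli1 u) w
      = (∫ x in I, conj (u x 0) * w x 1) + ∫ x in I, conj (u x 1) * w x 0 := by
  rw [L2.inner_def, ← integral_add (u.integrable_mul_conj w 0 1) (u.integrable_mul_conj w 1 0)]
  refine integral_congr_ae ?_
  filter_upwards [coeFn_matrixAct pauli1 u] with x hx
  rw [hx, PiLp.inner_apply, Fin.sum_univ_two]
  simp [pauli1, Matrix.mulVec, dotProduct, Fin.sum_univ_two]
  ring

/-- The Dirac expression `-i c σ₁ v + m c² σ₃ u`, with `v` in the place of the derivative
of `u`. -/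
def diracExpr (m c : ℝ) (u v : L2On I) : L2On I :=
  (-Complex.I * (c : ℂ)) • matrixAct I pauli1 v + ((m : ℂ) * (c : ℂ) ^ 2) • matrixAct I pauli3 u

/-- The mass terms cancel because `σ₃` is Hermitian with a real coefficient. What is left are
integrals of formal derivatives of `conj (u x 0) * w x 1` and `conj (u x 1) * w x 0`, ready for
integration by parts. -/
theorem inner_diracExpr_sub (m c : ℝ) (u v w z : L2On I) :
    inner ℂ (diracExpr m c u v) w - inner ℂ u (diracExpr m c w z)
      = Complex.I * c * ((∫ x in I, (conj (u x 0) * z x 1 + conj (v x 0) * w x 1))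
        + ∫ x in I, (conj (u x 1) * z x 0 + conj (v x 1) * w x 0)) := by
  rw [integral_add (u.integrable_mul_conj z 0 1) (v.integrable_mul_conj w 0 1),
    integral_add (u.integrable_mul_conj z 1 0) (v.integrable_mul_conj w 1 0)]
  simp only [diracExpr, inner_add_left, inner_add_right, inner_smul_left, inner_smul_right,
    map_mul, map_neg, Complex.conj_I, Complex.conj_ofReal, map_pow]
  rw [inner_matrixAct_left pauli3_isHermitian, ← inner_matrixAct_left pauli1_isHermitian u z,
    inner_matrixAct_pauli1, inner_matrixAct_pauli1]
  ring

end MatrixAct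

/-! ### Endpoint values and Green's formula on edges. -/

namespace MetricGraph

variable {V Es Eh : Type*} (G : MetricGraph V Es Eh)

/-- The value of a family of functions on the edges at an endpoint. -/
def endpointValue (f : Es ⊕ Eh → ℝ → Spinor) (p : Endpoint Es Eh) : Spinor :=
  f (edge p) (G.coord p)

theorem coord_notMem_interior (p : Endpoint Es Eh) :
    G.coord p ∉ interior (G.interval (edge p)) := by
  rcases p with (e | e) | e <;>
    simp only [coord, edge, interval, interior_Icc, interior_Ici, Set.mem_Ioo, Set.mem_Ioi,
      lt_irrefl, false_and, and_false, not_false_eq_true]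

theorem exists_cutoff (a : ℝ) {r : ℝ} (hr : 0 < r) :
    ∃ φ : ℝ → ℝ, ContDiff ℝ ∞ φ ∧ HasCompactSupport φ ∧ φ a = 1 ∧
      ∀ x, r ≤ dist x a → φ x = 0 := by
  let β : ContDiffBump a := ⟨r / 2, r, by positivity, by linarith⟩
  exact ⟨β, β.contDiff, β.hasCompactSupport,
    β.one_of_mem_closedBall (Metric.mem_closedBall_self (by positivity)),
    fun x hx => β.zero_of_le_dist hx⟩

/-- Every choice of endpoint values is attained by an `H¹` function. -/
theorem exists_isContRep_endpointValue_eq (s : Endpoint Es Eh → Spinor) :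
    ∃ (ψ v : G.L2) (f : Es ⊕ Eh → ℝ → Spinor), (∀ e, HasWeakDeriv (G.interval e) (ψ e) (v e)) ∧
      G.IsContRep ψ f ∧ ∀ p, G.endpointValue f p = s p := by
  have key : ∀ e : Es ⊕ Eh, ∃ (u v : L2On (G.interval e)) (f : ℝ → Spinor),
      HasWeakDeriv (G.interval e) u v ∧ Continuous f ∧ u =ᵐ[volume.restrict (G.interval e)] f ∧
      f 0 = s (Sum.inl e) ∧ ∀ e' : Es, e = Sum.inl e' → f (G.len e') = s (Sum.inr e') := by
    rintro (e | e)
    · obtain ⟨φ, h1, h2, h3, h4⟩ := exists_cutoff 0 (G.len_pos e)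
      obtain ⟨θ, k1, k2, k3, k4⟩ := exists_cutoff (G.len e) (G.len_pos e)
      refine ⟨_, _, fun x => φ x • s (Sum.inl (Sum.inl e)) + θ x • s (Sum.inr e),
        (hasWeakDeriv_testL2 h1 h2 (s (Sum.inl (Sum.inl e)))).add
          (hasWeakDeriv_testL2 k1 k2 (s (Sum.inr e))), ?_, ?_, ?_, ?_⟩
      · exact (h1.continuous.smul continuous_const).add (k1.continuous.smul continuous_const)
      · exact (Lp.coeFn_add _ _).trans ((coeFn_testL2 _ _ _).add (coeFn_testL2 _ _ _))
      · beta_reduce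
        rw [h3, k4 0 (by rw [dist_comm, Real.dist_0_eq_abs]; exact le_abs_self _)]
        simp
      · rintro e' he
        obtain rfl := Sum.inl.inj he
        beta_reduce
        rw [k3, h4 _ (by rw [Real.dist_0_eq_abs]; exact le_abs_self _)]
        simp
    · obtain ⟨φ, h1, h2, h3, -⟩ := exists_cutoff 0 one_pos
      refine ⟨_, _, fun x => φ x • s (Sum.inl (Sum.inr e)), hasWeakDeriv_testL2 h1 h2 _,
        h1.continuous.smul continuous_const, coeFn_testL2 _ _ _, ?_, ?_⟩
      · beta_reduce
        rw [h3, one_smul]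
      · rintro e' he
        cases he
  choose u v f hw hf huf h0 h1 using key
  refine ⟨WithLp.toLp 2 u, WithLp.toLp 2 v, f, hw, fun e => ⟨(hf e).continuousOn, huf e⟩, ?_⟩
  rintro (e | e)
  · exact h0 e
  · exact h1 _ e rfl

theorem exists_isContRep {χ z : G.L2} (h : ∀ e, HasWeakDeriv (G.interval e) (χ e) (z e)) :
    ∃ g, G.IsContRep χ g := by
  have key : ∀ e, ∃ g : ℝ → Spinor, ContinuousOn g (G.interval e) ∧
      χ e =ᵐ[volume.restrict (G.interval e)] g := fun e => by
    obtain ⟨hI, hne⟩ : (G.interval e).OrdConnected ∧ (interior (G.interval e)).Nonempty := by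
      rcases e with e | e
      · exact ⟨Set.ordConnected_Icc, by
          simpa only [interval, interior_Icc, Set.nonempty_Ioo] using G.len_pos e⟩
      · exact ⟨Set.ordConnected_Ici, by
          simpa only [interval, interior_Ici] using Set.nonempty_Ioi⟩
    obtain ⟨g, hg, hχg, -⟩ := (h e).exists_primitive hI hne (G.volume_interval_diff e)
    exact ⟨g, hg.continuousOn, hχg⟩
  choose g hg using key
  exact ⟨g, hg⟩

open Classical in
/-- The element of `L²(G, ℂ²)` given on the edge `e` by a test function and vanishing
on the other edges. -/
def edgeTest (e : Es ⊕ Eh) (b : L2On (G.interval e)) : G.L2 :=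
  WithLp.toLp 2 (Pi.single e b)

theorem edgeTest_same (e : Es ⊕ Eh) (b : L2On (G.interval e)) : G.edgeTest e b e = b := by
  classical exact Pi.single_eq_same _ _

theorem edgeTest_of_ne {e e' : Es ⊕ Eh} (h : e' ≠ e) (b : L2On (G.interval e)) :
    G.edgeTest e b e' = 0 := by
  classical exact Pi.single_eq_of_ne h _

theorem hasWeakDeriv_edgeTest {e : Es ⊕ Eh} {b b' : L2On (G.interval e)}
    (h : HasWeakDeriv (G.interval e) b b') (e' : Es ⊕ Eh) :
    HasWeakDeriv (G.interval e') (G.edgeTest e b e') (G.edgeTest e b' e') := by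
  by_cases he : e' = e
  · subst he
    rwa [edgeTest_same, edgeTest_same]
  · rw [edgeTest_of_ne G he, edgeTest_of_ne G he]
    exact HasWeakDeriv.zero _

/-- Green's formula on an edge. -/
theorem inner_diracExpr_sub_eq (m c : ℝ) (e : Es ⊕ Eh) {u v w z : L2On (G.interval e)}
    (huv : HasWeakDeriv _ u v) (hwz : HasWeakDeriv _ w z) {f g : ℝ → Spinor}
    (hf : ContinuousOn f (G.interval e)) (hg : ContinuousOn g (G.interval e))
    (huf : u =ᵐ[volume.restrict (G.interval e)] f)
    (hwg : w =ᵐ[volume.restrict (G.interval e)] g) :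
    inner ℂ (diracExpr m c u v) w - inner ℂ u (diracExpr m c w z)
      = Complex.I * c * ((Sum.elim (fun e' => conj (f (G.len e') 0) * g (G.len e') 1
          + conj (f (G.len e') 1) * g (G.len e') 0) (fun _ => 0) e)
        - (conj (f 0 0) * g 0 1 + conj (f 0 1) * g 0 0)) := by
  rw [inner_diracExpr_sub]
  rcases e with e | e
  · have h := setIntegral_Icc_conj_mul_of_hasWeakDeriv (G.len_pos e) huv hwz hf hg huf hwg
    erw [h 0 1, h 1 0]
    simp only [Sum.elim_inl]
    ring
  · have h := setIntegral_Ici_conj_mul_of_hasWeakDeriv huv hwz hf hg huf hwg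
    erw [h 0 1, h 1 0]
    simp only [Sum.elim_inr]
    ring

variable [Fintype Es] [Fintype Eh]

/-! ### Symmetry, density and the adjoint of the Dirac operator. -/

section Dirac

variable (m c : ℝ)

theorem dirac_apply (ψ : (G.dirac m c).domain) (e : Es ⊕ Eh) {v : L2On (G.interval e)}
    (h : HasWeakDeriv (G.interval e) ((ψ : G.L2) e) v) :
    (G.dirac m c ψ) e = diracExpr m c ((ψ : G.L2) e) v := by
  have hv := (hasWeakDeriv_weakDeriv (G.interval e) (G.volume_interval_diff e)
    ⟨(ψ : G.L2) e, ψ.2.1 e⟩).unique (G.volume_interval_diff e) h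
  rw [← hv]
  rfl

/-- Green's formula on a metric graph. -/
theorem sum_inner_diracExpr_sub {ψ v χ z : G.L2} {f g : Es ⊕ Eh → ℝ → Spinor}
    (hψ : ∀ e, HasWeakDeriv (G.interval e) (ψ e) (v e))
    (hχ : ∀ e, HasWeakDeriv (G.interval e) (χ e) (z e))
    (hf : G.IsContRep ψ f) (hg : G.IsContRep χ g) :
    ∑ e, inner ℂ (diracExpr m c (ψ e) (v e)) (χ e) - ∑ e, inner ℂ (ψ e) (diracExpr m c (χ e) (z e))
      = -(Complex.I * c) * ((∑ p, sign p * conj (G.endpointValue f p 0) * G.endpointValue g p 1)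
        + ∑ p, sign p * conj (G.endpointValue f p 1) * G.endpointValue g p 0) := by
  rw [← Finset.sum_sub_distrib, ← Finset.sum_add_distrib]
  simp only [G.inner_diracExpr_sub_eq m c _ (hψ _) (hχ _) (hf _).1 (hg _).1 (hf _).2 (hg _).2]
  rw [← Finset.mul_sum, neg_mul, ← mul_neg]
  congr 1
  simp only [Fintype.sum_sum_type, Sum.elim_inl, Sum.elim_inr, endpointValue, edge, coord, sign,
    Finset.sum_sub_distrib, Finset.sum_add_distrib, neg_mul, one_mul, Finset.sum_neg_distrib,
    Finset.sum_const_zero]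
  ring

open Classical in
-- Grouped by vertices, `a` is constant on each fibre and factors out of a sum that vanishes by
-- balance. This is the duality of the two vertex conditions.
theorem sum_sign_mul_mul_eq_zero [Fintype V] {a b : Endpoint Es Eh → ℂ}
    (ha : ∀ p q, G.vertex p = G.vertex q → a p = a q)
    (hb : ∀ v : V, ∑ p : Endpoint Es Eh with G.vertex p = v, sign p * b p = 0) :
    ∑ p, sign p * a p * b p = 0 := by
  rw [← Finset.sum_fiberwise (g := G.vertex)]
  refine Finset.sum_eq_zero fun v _ => ?_
  by_cases h : ∃ q, G.vertex q = v
  · obtain ⟨q, rfl⟩ := h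
    have := congrArg (a q * ·) (hb (G.vertex q))
    simp only [mul_zero, Finset.mul_sum] at this
    rw [← this]
    refine Finset.sum_congr rfl fun p hp => ?_
    rw [ha p q (Finset.mem_filter.1 hp).2]
    ring
  · rw [Finset.filter_false_of_mem fun p _ hp => h ⟨p, hp⟩, Finset.sum_empty]

theorem inner_edgeTest (χ : G.L2) (e : Es ⊕ Eh) (b : L2On (G.interval e)) :
    inner ℂ χ (G.edgeTest e b) = inner ℂ (χ e) b := by
  rw [PiLp.inner_apply, Finset.sum_eq_single e, edgeTest_same]
  · intro e' _ h
    rw [edgeTest_of_ne G h, inner_zero_right]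
  · simp

/-- Such a spinor vanishes at every endpoint, so both vertex conditions are trivial. -/
theorem edgeTest_mem_diracDomain (e : Es ⊕ Eh) {φ : ℝ → ℝ} (hφ : ContDiff ℝ ∞ φ)
    (hc : HasCompactSupport φ) (hs : tsupport φ ⊆ interior (G.interval e)) (s : Spinor) :
    G.edgeTest e (testL2 (G.interval e) hφ.continuous hc s) ∈ G.diracDomain := by
  classical
  have hzero : ∀ p : Endpoint Es Eh,
      (if edge p = e then φ (G.coord p) • s else 0) = 0 := fun p => by
    split_ifs with h
    · rw [image_eq_zero_of_notMem_tsupport fun h' => G.coord_notMem_interior p (h ▸ hs h'),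
        zero_smul]
    · rfl
  refine ⟨fun e' => ⟨_, G.hasWeakDeriv_edgeTest (hasWeakDeriv_testL2 hφ hc s) e'⟩,
    fun e' x => if e' = e then φ x • s else 0, fun e' => ?_, fun p q _ => ?_, fun v => ?_⟩
  · by_cases he : e' = e
    · subst he
      simp only [if_true, edgeTest_same]
      exact ⟨(hφ.continuous.smul continuous_const).continuousOn, coeFn_testL2 _ _ _⟩
    · simp only [if_neg he, edgeTest_of_ne G he]
      exact ⟨continuousOn_const, Lp.coeFn_zero _ _ _⟩
  · simp only [hzero]
  · simp only [hzero]
    simp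

/-- Orthogonality of `χ` to the interior test spinors says that `χ e` is a weak derivative of `0`,
so `χ e = 0` by uniqueness. -/
theorem dense_diracDomain : Dense (G.diracDomain : Set G.L2) := by
  rw [Submodule.dense_iff_topologicalClosure_eq_top, Submodule.topologicalClosure_eq_top_iff,
    Submodule.eq_bot_iff]
  intro χ hχ
  ext1 e
  have hw : HasWeakDeriv (G.interval e) 0 (χ e) := by
    intro φ hφ hc hs
    have h0 : ∫ x in G.interval e, φ x • χ e x = 0 := by
      refine ext_inner_right ℂ fun s => ?_
      rw [← inner_testL2 hφ.continuous hc, ← inner_edgeTest, inner_zero_left]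
      exact (Submodule.mem_orthogonal' _ _).1 hχ _ (G.edgeTest_mem_diracDomain e hφ hc hs s)
    rw [h0, neg_zero]
    refine integral_eq_zero_of_ae ?_
    filter_upwards [Lp.coeFn_zero Spinor 2 (volume.restrict (G.interval e))] with x hx
    rw [hx]
    simp
  exact hw.unique (G.volume_interval_diff e) (HasWeakDeriv.zero _)

/-- Green's formula without boundary terms under the Kirchhoff-type vertex conditions. -/
theorem sum_inner_diracExpr_eq [Fintype V] {ψ v χ z : G.L2}
    (hψ : ψ ∈ G.diracDomain) (hv : ∀ e, HasWeakDeriv (G.interval e) (ψ e) (v e))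
    (hχ : χ ∈ G.diracDomain) (hz : ∀ e, HasWeakDeriv (G.interval e) (χ e) (z e)) :
    ∑ e, inner ℂ (diracExpr m c (ψ e) (v e)) (χ e)
      = ∑ e, inner ℂ (ψ e) (diracExpr m c (χ e) (z e)) := by
  obtain ⟨-, f, hf, hfc, hfb⟩ := hψ
  obtain ⟨-, g, hg, hgc, hgb⟩ := hχ
  have h1 : ∑ p, sign p * conj (G.endpointValue f p 0) * G.endpointValue g p 1 = 0 :=
    G.sum_sign_mul_mul_eq_zero (a := fun p => conj (G.endpointValue f p 0))
      (b := fun p => G.endpointValue g p 1) (fun p q h => congrArg conj (hfc p q h)) hgb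
  have h2 : ∑ p, sign p * conj (G.endpointValue f p 1) * G.endpointValue g p 0 = 0 := by
    -- The roles are exchanged: `g` supplies the continuous factor, and the conjugate of `f` remains
    -- balanced because the signs are real.
    have h3 := G.sum_sign_mul_mul_eq_zero (a := fun p => G.endpointValue g p 0)
      (b := fun p => conj (G.endpointValue f p 1)) hgc (fun v => by
        have := congrArg conj (hfb v)
        rw [map_sum, map_zero] at this
        rw [← this]
        refine Finset.sum_congr rfl fun p _ => ?_
        rw [map_mul]
        rcases p with p | p <;> simp [sign, endpointValue])
    rw [← h3]
    exact Finset.sum_congr rfl fun p _ => by ring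
  rw [← sub_eq_zero, G.sum_inner_diracExpr_sub m c hv hz hf hg, h1, h2, add_zero, mul_zero]

theorem dirac_isFormalAdjoint_self [Fintype V] :
    (G.dirac m c).IsFormalAdjoint (G.dirac m c) := by
  intro ψ χ
  choose v hv using ψ.2.1
  choose z hz using χ.2.1
  rw [PiLp.inner_apply, PiLp.inner_apply]
  simpa only [G.dirac_apply m c ψ _ (hv _), G.dirac_apply m c χ _ (hz _)] using
    G.sum_inner_diracExpr_eq m c (v := WithLp.toLp 2 v) (z := WithLp.toLp 2 z) ψ.2 hv χ.2 hz

variable {m c} in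
/-- If `⟨η, ψ⟩ = ⟨χ, D ψ⟩` for all `ψ` in the domain of the Dirac operator `D`, then `χ` is in `H¹`
on every edge, and `η` is given by the Dirac expression of `χ`. -/
theorem exists_hasWeakDeriv_of_inner_eq (hc0 : c ≠ 0) {χ η : G.L2}
    (h : ∀ ψ v : G.L2, ψ ∈ G.diracDomain → (∀ e, HasWeakDeriv (G.interval e) (ψ e) (v e)) →
      inner ℂ η ψ = ∑ e, inner ℂ (χ e) (diracExpr m c (ψ e) (v e)))
    (e : Es ⊕ Eh) :
    ∃ z, HasWeakDeriv (G.interval e) (χ e) z ∧ η e = diracExpr m c (χ e) z := by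
  set σ₁ := matrixAct (G.interval e) pauli1 with hσ
  set w : L2On (G.interval e) :=
    ((m : ℂ) * (c : ℂ) ^ 2) • matrixAct (G.interval e) pauli3 (χ e) - η e with hw
  have hcC : (c : ℂ) ≠ 0 := Complex.ofReal_ne_zero.2 hc0
  have hσσ : ∀ u, σ₁ (σ₁ u) = u := fun u => by
    rw [hσ, matrixAct_matrixAct, pauli1_mul_self, matrixAct_one]
  -- Moving `-ic σ₁` and `mc² σ₃` onto `χ` turns the adjoint relation on interior test spinors into
  -- `(ic σ₁ χ)' = mc² σ₃ χ - η`.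
  have key : HasWeakDeriv (G.interval e) ((Complex.I * c) • σ₁ (χ e)) w := by
    intro φ hφ hc hs
    refine ext_inner_right ℂ fun s => ?_
    have hd := hasWeakDeriv_testL2 (I := G.interval e) hφ hc s
    have h1 := h _ _ (G.edgeTest_mem_diracDomain e hφ hc hs s) (G.hasWeakDeriv_edgeTest hd)
    rw [inner_edgeTest, Finset.sum_eq_single e
      (fun e' _ he => by
        rw [edgeTest_of_ne G he, edgeTest_of_ne G he, diracExpr, map_zero, map_zero, smul_zero,
          smul_zero, add_zero, inner_zero_right]) (by simp),
      edgeTest_same, edgeTest_same, diracExpr, inner_add_right, inner_smul_right, inner_smul_right,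
      ← inner_matrixAct_left pauli1_isHermitian, ← inner_matrixAct_left pauli3_isHermitian] at h1
    rw [inner_neg_left, ← inner_testL2 (hφ.continuous_deriv (by simp)) hc.deriv,
      ← inner_testL2 hφ.continuous hc, hw, inner_sub_left, inner_smul_left, inner_smul_left, h1]
    simp only [map_mul, map_pow, Complex.conj_I, Complex.conj_ofReal]
    ring
  -- The inverse of `ic σ₁` is `(-i/c) σ₁`.
  refine ⟨(-Complex.I / c) • σ₁ w, ?_, ?_⟩
  · have h2 := (key.matrixAct pauli1).smul (-Complex.I / c)
    rw [map_smul, ← hσ, hσσ, smul_smul] at h2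
    rwa [show -Complex.I / c * (Complex.I * c) = 1 by
      field_simp
      simp, one_smul] at h2
  · rw [diracExpr, map_smul, ← hσ, hσσ, smul_smul, show -Complex.I * c * (-Complex.I / c) = -1 by
      field_simp
      simp, hw]
    simp

variable {m c} in
open Classical in
-- The boundary form vanishes against all endpoint data `(a, b)` with `a` continuous and `b`
-- balanced, since every such pair is attained in the domain. Special choices of `a` and `b` then
-- isolate each vertex condition on `g`.
theorem vertexConditions_of_sum_inner_eq (hc0 : c ≠ 0) {χ z : G.L2}
    (hz : ∀ e, HasWeakDeriv (G.interval e) (χ e) (z e)) {g : Es ⊕ Eh → ℝ → Spinor}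
    (hg : G.IsContRep χ g)
    (h : ∀ ψ v : G.L2, ψ ∈ G.diracDomain → (∀ e, HasWeakDeriv (G.interval e) (ψ e) (v e)) →
      ∑ e, inner ℂ (diracExpr m c (ψ e) (v e)) (χ e)
        = ∑ e, inner ℂ (ψ e) (diracExpr m c (χ e) (z e))) :
    G.ContinuityCondition g ∧ G.BalanceCondition g := by
  have key : ∀ a b : Endpoint Es Eh → ℂ, (∀ p q, G.vertex p = G.vertex q → a p = a q) →
      (∀ v : V, ∑ p : Endpoint Es Eh with G.vertex p = v, sign p * b p = 0) →
      (∑ p, sign p * conj (a p) * G.endpointValue g p 1)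
        + ∑ p, sign p * conj (b p) * G.endpointValue g p 0 = 0 := by
    intro a b ha hb
    obtain ⟨ψ, v, f, hv, hf, hs⟩ := G.exists_isContRep_endpointValue_eq fun p => !₂[a p, b p]
    have h1 : ∀ p, G.endpointValue f p 0 = a p := fun p => by rw [hs p]; rfl
    have h2 : ∀ p, G.endpointValue f p 1 = b p := fun p => by rw [hs p]; rfl
    have hψ : ψ ∈ G.diracDomain := by
      refine ⟨fun e => ⟨_, hv e⟩, f, hf, fun p q hpq => ?_, fun v => ?_⟩
      · exact (h1 p).trans ((ha p q hpq).trans (h1 q).symm)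
      · rw [← hb v]
        exact Finset.sum_congr rfl fun p _ => congrArg (sign p * ·) (h2 p)
    have h3 := G.sum_inner_diracExpr_sub m c hv hz hf hg
    rw [h ψ v hψ hv, sub_self, eq_comm, mul_eq_zero, neg_eq_zero, mul_eq_zero,
      or_iff_right (by simp [Complex.I_ne_zero, hc0])] at h3
    simpa only [h1, h2] using h3
  have hsign : ∀ p : Endpoint Es Eh, sign p * sign p = 1 ∧ conj (sign p) = sign p := by
    rintro (p | p) <;> simp [sign]
  refine ⟨fun p q hpq => ?_, fun v => ?_⟩
  -- With signs included, unit flux enters at `p` and leaves at `q`. This is balanced as both lie at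
  -- one vertex, and it leaves the difference of the first components of `g` at `p` and `q`.
  · have h1 := key 0 (fun r => (if r = p then sign r else 0) - (if r = q then sign r else 0))
      (fun _ _ _ => rfl) (fun v => by
        simp only [mul_sub, Finset.sum_sub_distrib, mul_ite, mul_zero, (hsign _).1,
          Finset.sum_ite_eq', Finset.mem_filter, Finset.mem_univ, true_and, hpq, sub_self])
    have h2 : ∀ r r' : Endpoint Es Eh, sign r * conj (if r = r' then sign r else 0)
        = if r = r' then 1 else 0 := fun r r' => by
      split_ifs
      · rw [(hsign r).2, (hsign r).1]
      · simp
    simp only [Pi.zero_apply, map_zero, mul_zero, zero_mul, Finset.sum_const_zero, zero_add,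
      map_sub, mul_sub, sub_mul, h2, Finset.sum_sub_distrib, ite_mul, one_mul,
      Finset.sum_ite_eq', Finset.mem_univ, if_true, sub_eq_zero] at h1
    exact h1
  -- The indicator of the vertex `v` is continuous vertex data and picks out the balance sum of `g`
  -- at `v`.
  · have h1 := key (fun p => if G.vertex p = v then 1 else 0) 0
      (fun p q hpq => by simp only [hpq]) (fun v => by simp)
    simp only [Pi.zero_apply, map_zero, mul_zero, zero_mul, Finset.sum_const_zero, add_zero] at h1
    rw [Finset.sum_filter]
    refine (Finset.sum_congr rfl fun p _ => ?_).trans h1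
    split_ifs
    · rw [map_one, mul_one]
      rfl
    · rw [map_zero, mul_zero, zero_mul]

end Dirac

end MetricGraph

end

/-! ### Self-adjointness. -/

theorem mainTheorem2 {V Es Eh : Type*} [Fintype V] [Fintype Es] [Fintype Eh]
    (G : MetricGraph V Es Eh) (m c : ℝ) (hm : 0 < m) (hc : 0 < c) :
    IsSelfAdjoint (G.dirac m c) := by
  have hdense : Dense ((G.dirac m c).domain : Set G.L2) := G.dense_diracDomain
  have hle := LinearPMap.IsFormalAdjoint.le_adjoint hdense (G.dirac_isFormalAdjoint_self m c)
  rw [LinearPMap.isSelfAdjoint_def]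
  -- Symmetry already gives `D ≤ D*`; only the inclusion of the domain of `D*` in that of `D`
  -- remains.
  refine (LinearPMap.eq_of_le_of_domain_eq hle (le_antisymm hle.1 fun χ hχ => ?_)).symm
  set η : G.L2 := (G.dirac m c).adjoint ⟨χ, hχ⟩
  have h : ∀ ψ v : G.L2, ψ ∈ G.diracDomain →
      (∀ e, HasWeakDeriv (G.interval e) (ψ e) (v e)) →
      inner ℂ η ψ = ∑ e, inner ℂ (χ e) (diracExpr m c (ψ e) (v e)) := fun ψ v hψ hv => by
    have h1 := LinearPMap.adjoint_isFormalAdjoint hdense ⟨χ, hχ⟩ ⟨ψ, hψ⟩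
    rw [PiLp.inner_apply _ ((G.dirac m c) ⟨ψ, hψ⟩)] at h1
    simpa only [G.dirac_apply m c ⟨ψ, hψ⟩ _ (hv _)] using h1
  choose z hz hη using G.exists_hasWeakDeriv_of_inner_eq hc.ne' h
  obtain ⟨g, hg⟩ := G.exists_isContRep (z := WithLp.toLp 2 z) hz
  refine ⟨fun e => ⟨_, hz e⟩, g, hg,
    G.vertexConditions_of_sum_inner_eq (m := m) hc.ne' (z := WithLp.toLp 2 z) hz hg
      fun ψ v hψ hv => ?_⟩
  -- Conjugation exchanges the arguments of the inner products, bringing the adjoint relation to the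
  -- order used in Green's formula.
  have h1 := congrArg (starRingEnd ℂ) (h ψ v hψ hv)
  rw [inner_conj_symm, map_sum, PiLp.inner_apply] at h1
  simp only [inner_conj_symm, hη] at h1
  exact h1.symm
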